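/- **Corollary 13.2 (Dedecker).** A (strict) 2-group $\mathbb G$ is a group object in groupoids. Its crossed module $[\partial\colon G_2\to G_1]$ consists of the group $G_1$ of objects, the group $G_2$ of arrows out of the identity object, the target map $\partial$, and the right action $\alpha^{g}=g^{-1}\alpha g$ of $G_1$ on $G_2$ ($g$ viewed as an identity arrow). Let $\mathbf{2Gp}$ be the category of 2-groups and strict morphisms. A strict morphism is an equivalence if it induces isomorphisms on $\pi_1$ (isomorphism classes of objects) and on $\pi_2$ (automorphisms of the identity object), and $\mathrm{Ho}(\mathbf{2Gp})$ is obtained from $\mathbf{2Gp}$ by inverting all equivalences. A group $\Gamma$ is regarded as the 2-group with objects $\Gamma$ and only identity arrows. For a group $\Gamma$ and a 2-group $\mathbb G$ let $\mathcal B(\Gamma,\mathbb G)$ be the groupoid of pairs $(E,\rho)$, where $1\to G_2\to E\to\Gamma\to 1$ is a group extension and $\rho\colon E\to G_1$ is a homomorphism with $\rho|_{G_2}=\partial$ and $\alpha^{\rho(x)}=x^{-1}\alpha x$ for all $x\in E$, $\alpha\in G_2$; a morphism $(E,\rho)\to(E',\rho')$ is an isomorphism $f\colon E\to E'$ that is the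 identity on $G_2$ and on $\Gamma$ and satisfies $\rho'\circ f=\rho$. A homomorphism $\chi\colon\Gamma'\to\Gamma$ acts on isomorphism classes by $(E,\rho)\mapsto(E\times_\Gamma\Gamma',\rho\circ \mathrm{pr}_1)$. A strict morphism $P\colon\mathbb G\to\mathbb G'$, with components $p_1\colon G_1\to G_1'$ and $p_2\colon G_2\to G_2'$, acts by $P_*(E,\rho)=(E\ltimes^{G_2}G_2',\rho')$. Here $E\ltimes^{G_2}G_2'$ is the semidirect product of $E$ and $G_2'$ ($E$ acting on $G_2'$ through $p_1\circ\rho$) with each $\alpha\in G_2\subseteq E$ identified with $p_2(\alpha)\in G_2'$, and $\rho'$ is $p_1\circ\rho$ on $E$ and $\partial$ on $G_2'$. Then there is a bijection $$\mathrm{Hom}_{\mathrm{Ho}(\mathbf{2Gp})}(\Gamma,\mathbb G)\;\xrightarrow{\ \sim\ }\;\pi_0\,\mathcal B(\Gamma,\mathbb G)$$ onto the set of isomorphism classes of such pairs, natural in the group $\Gamma$ and in the 2-group $\mathbb G$. It can be chosen so that, for every equivalence $w\colon\mathbb F\to\Gamma$ of 2-groups and every strict morphism $P\colon\mathbb F\to\mathbb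 G$, the class of $P\circ w^{-1}$ is sent to the isomorphism class of $P_*(F_1,\mathrm{id})$, where $F_1$ is regarded as an extension of $\Gamma$ by $F_2$ through $\partial\colon F_2\to F_1$ and $w$. -/

import Mathlib

open CategoryTheory

universe u

noncomputable section

/-! ### Strict 2-groups -/

/-- A (strict) 2-group: a groupoid object in the category of groups, equivalently a group object
in the category of groupoids. There are a group of objects and a group of arrows; source, target
and identity are group homomorphisms, and so is the (partially defined) composition of arrows,
which makes the objects and arrows into a groupoid. `comp f g` is "first `f`, then `g`". -/
structure TwoGroup : Type (u + 1) where
  Ob : Type u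
  Arr : Type u
  [groupOb : Group Ob]
  [groupArr : Group Arr]
  src : Arr →* Ob
  tgt : Arr →* Ob
  ident : Ob →* Arr
  comp : (f g : Arr) → tgt f = src g → Arr
  src_ident : ∀ a, src (ident a) = a
  tgt_ident : ∀ a, tgt (ident a) = a
  src_comp : ∀ f g h, src (comp f g h) = src f
  tgt_comp : ∀ f g h, tgt (comp f g h) = tgt g
  ident_comp : ∀ f, comp (ident (src f)) f (tgt_ident _) = f
  comp_ident : ∀ f, comp f (ident (tgt f)) (src_ident _).symm = f
  assoc : ∀ (f g k : Arr) (h₁ : tgt f = src g) (h₂ : tgt g = src k),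
    comp (comp f g h₁) k ((tgt_comp _ _ _).trans h₂) =
      comp f (comp g k h₂) (h₁.trans (src_comp _ _ _).symm)
  /-- composition is a group homomorphism on the group of composable pairs -/
  comp_mul : ∀ (f g f' g' : Arr) (h : tgt f = src g) (h' : tgt f' = src g'),
    comp (f * f') (g * g') (by rw [map_mul, map_mul, h, h']) = comp f g h * comp f' g' h'
  /-- every arrow is invertible for composition -/
  exists_inv : ∀ f : Arr, ∃ (g : Arr) (h₁ : tgt f = src g) (h₂ : tgt g = src f),
    comp f g h₁ = ident (src f) ∧ comp g f h₂ = ident (tgt f)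

namespace TwoGroup

attribute [instance] groupOb groupArr

/-- A strict morphism of 2-groups: a functor that respects the group operations. -/
@[ext]
structure Hom (G H : TwoGroup.{u}) : Type u where
  onOb : G.Ob →* H.Ob
  onArr : G.Arr →* H.Arr
  src_map : ∀ f, H.src (onArr f) = onOb (G.src f)
  tgt_map : ∀ f, H.tgt (onArr f) = onOb (G.tgt f)
  ident_map : ∀ a, H.ident (onOb a) = onArr (G.ident a)
  comp_map : ∀ (f g : G.Arr) (h : G.tgt f = G.src g),
    H.comp (onArr f) (onArr g) (by rw [tgt_map, src_map, h]) = onArr (G.comp f g h)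

/-- The category **2Gp** of 2-groups and strict morphisms. -/
instance : Category.{u} TwoGroup.{u} where
  Hom := Hom
  id G :=
    { onOb := MonoidHom.id _
      onArr := MonoidHom.id _
      src_map := fun _ => rfl
      tgt_map := fun _ => rfl
      ident_map := fun _ => rfl
      comp_map := fun _ _ _ => rfl }
  comp P Q :=
    { onOb := Q.onOb.comp P.onOb
      onArr := Q.onArr.comp P.onArr
      src_map := fun f => by simp [P.src_map, Q.src_map]
      tgt_map := fun f => by simp [P.tgt_map, Q.tgt_map]
      ident_map := fun a => by simp [P.ident_map, Q.ident_map]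
      comp_map := fun f g h => by
        simp only [MonoidHom.comp_apply]
        rw [Q.comp_map _ _ (by rw [P.tgt_map, P.src_map, h]), P.comp_map] }

/-- The relation "isomorphic" on the objects of a 2-group; it is compatible with products. -/
def isoCon (G : TwoGroup.{u}) : Con G.Ob where
  r a b := ∃ f : G.Arr, G.src f = a ∧ G.tgt f = b
  iseqv :=
    { refl := fun a => ⟨G.ident a, G.src_ident a, G.tgt_ident a⟩
      symm := by
        rintro _ _ ⟨f, rfl, rfl⟩
        obtain ⟨g, h₁, h₂, -⟩ := G.exists_inv f
        exact ⟨g, h₁.symm, h₂⟩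
      trans := by
        rintro _ _ _ ⟨f, rfl, rfl⟩ ⟨g, h, rfl⟩
        exact ⟨G.comp f g h.symm, G.src_comp _ _ _, G.tgt_comp _ _ _⟩ }
  mul' := by
    rintro _ _ _ _ ⟨f, rfl, rfl⟩ ⟨g, rfl, rfl⟩
    exact ⟨f * g, map_mul _ _ _, map_mul _ _ _⟩

/-- `π₁ G`: the group of isomorphism classes of objects. -/
abbrev pi₁ (G : TwoGroup.{u}) : Type u := G.isoCon.Quotient

/-- `π₂ G`: the group of automorphisms of the identity object (for these, the group operation of
`G` and the composition agree, by the interchange law). -/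
abbrev pi₂ (G : TwoGroup.{u}) : Subgroup G.Arr := G.src.ker ⊓ G.tgt.ker

/-- The homomorphism induced on `π₁`. -/
def pi₁Map {G H : TwoGroup.{u}} (P : G ⟶ H) : G.pi₁ →* H.pi₁ :=
  G.isoCon.lift (H.isoCon.mk'.comp P.onOb) (by
    rintro _ _ ⟨f, rfl, rfl⟩
    exact (Con.eq _).2 ⟨P.onArr f, P.src_map f, P.tgt_map f⟩)

/-- The homomorphism induced on `π₂`. -/
def pi₂Map {G H : TwoGroup.{u}} (P : G ⟶ H) : G.pi₂ →* H.pi₂ :=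
  (P.onArr.comp G.pi₂.subtype).codRestrict H.pi₂ (fun f => by
    have h := f.2
    simp only [Subgroup.mem_inf, MonoidHom.mem_ker] at h
    simp only [Subgroup.mem_inf, MonoidHom.mem_ker, MonoidHom.comp_apply, Subgroup.coe_subtype,
      P.src_map, P.tgt_map, h.1, h.2, map_one, and_self])

/-- The equivalences of 2-groups: the strict morphisms that induce isomorphisms on `π₁` and
`π₂`. -/
def equivalences : MorphismProperty TwoGroup.{u} := fun _ _ P =>
  Function.Bijective (pi₁Map P) ∧ Function.Bijective (pi₂Map P)

/-- The homotopy category **Ho(2Gp)**: the category of 2-groups with all equivalences inverted. -/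
abbrev Ho : Type (u + 1) := equivalences.{u}.Localization

/-- The localization functor **2Gp** ⥤ **Ho(2Gp)**. -/
abbrev toHo : TwoGroup.{u} ⥤ Ho.{u} := equivalences.{u}.Q

/-- A group, viewed as a 2-group all of whose arrows are identities. -/
def discrete : GrpCat.{u} ⥤ TwoGroup.{u} where
  obj Γ :=
    { Ob := Γ
      Arr := Γ
      src := MonoidHom.id _
      tgt := MonoidHom.id _
      ident := MonoidHom.id _
      comp := fun f _ _ => f
      src_ident := fun _ => rfl
      tgt_ident := fun _ => rfl
      src_comp := fun _ _ _ => rfl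
      tgt_comp := fun _ _ h => h
      ident_comp := fun _ => rfl
      comp_ident := fun _ => rfl
      assoc := fun _ _ _ _ _ => rfl
      comp_mul := fun _ _ _ _ _ _ => rfl
      exists_inv := fun f => ⟨f, rfl, rfl, rfl, rfl⟩ }
  map χ :=
    { onOb := χ.hom
      onArr := χ.hom
      src_map := fun _ => rfl
      tgt_map := fun _ => rfl
      ident_map := fun _ => rfl
      comp_map := fun _ _ _ => rfl }

end TwoGroup

/-! ### Crossed modules -/

/-- A crossed module `[∂ : G₂ → G₁]`, with a right action `act α a = α ^ a` of `G₁` on `G₂` by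
group automorphisms. -/
structure CrossedModule : Type (u + 1) where
  G₂ : Type u
  G₁ : Type u
  [group₂ : Group G₂]
  [group₁ : Group G₁]
  bd : G₂ →* G₁
  act : G₂ → G₁ → G₂
  act_one : ∀ α, act α 1 = α
  act_mul : ∀ α a b, act α (a * b) = act (act α a) b
  mul_act : ∀ α β a, act (α * β) a = act α a * act β a
  act_bd : ∀ α β, act β (bd α) = α⁻¹ * β * α
  bd_act : ∀ β a, bd (act β a) = a⁻¹ * bd β * a

namespace CrossedModule

attribute [instance] group₂ group₁

/-- A strict morphism of crossed modules. -/
@[ext]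
structure Hom (G H : CrossedModule.{u}) : Type u where
  p₂ : G.G₂ →* H.G₂
  p₁ : G.G₁ →* H.G₁
  bd_map : ∀ α, H.bd (p₂ α) = p₁ (G.bd α)
  act_map : ∀ α a, H.act (p₂ α) (p₁ a) = p₂ (G.act α a)

/-- The category **XMod** of crossed modules and strict morphisms. -/
instance : Category.{u} CrossedModule.{u} where
  Hom := Hom
  id G :=
    { p₂ := MonoidHom.id _
      p₁ := MonoidHom.id _
      bd_map := fun _ => rfl
      act_map := fun _ _ => rfl }
  comp P Q :=
    { p₂ := Q.p₂.comp P.p₂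
      p₁ := Q.p₁.comp P.p₁
      bd_map := fun α => by simp [P.bd_map, Q.bd_map]
      act_map := fun α a => by simp [P.act_map, Q.act_map] }

theorem one_act (G : CrossedModule.{u}) (a : G.G₁) : G.act 1 a = 1 := by
  have h := G.mul_act 1 1 a
  rw [mul_one] at h
  exact left_eq_mul.1 h

/-- The left action `a • α = α ^ (a⁻¹)`, as a homomorphism to the automorphism group. -/
def leftAct (G : CrossedModule.{u}) : G.G₁ →* MulAut G.G₂ where
  toFun a :=
    { toFun := fun α => G.act α a⁻¹
      invFun := fun α => G.act α a
      left_inv := fun α => by simp [← G.act_mul, G.act_one]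
      right_inv := fun α => by simp [← G.act_mul, G.act_one]
      map_mul' := fun α β => G.mul_act α β _ }
  map_one' := by ext α; simp [G.act_one]
  map_mul' a b := by ext α; simp [G.act_mul]

theorem leftAct_apply (G : CrossedModule.{u}) (a : G.G₁) (α : G.G₂) :
    G.leftAct a α = G.act α a⁻¹ := rfl

end CrossedModule

namespace TwoGroup

/-- In a 2-group, arrows out of the identity object commute with arrows into it. -/
theorem mul_comm_of_src_tgt (G : TwoGroup.{u}) {f g : G.Arr} (hf : G.src f = 1)
    (hg : G.tgt g = 1) : f * g = g * f := by
  have hi : G.ident 1 = 1 := map_one _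
  have h1 : G.comp (g * 1) (1 * f) (by simp [hf, hg]) = g * f := by
    have := G.comp_mul g 1 1 f (by simp [hg]) (by simp [hf])
    rw [this]
    congr 1
    · have := G.comp_ident g
      simp only [hg, hi] at this
      exact this
    · have := G.ident_comp f
      simp only [hf, hi] at this
      exact this
  have h2 : G.comp (1 * g) (f * 1) (by simp [hf, hg]) = f * g := by
    have := G.comp_mul 1 f g 1 (by simp [hf]) (by simp [hg])
    rw [this]
    congr 1
    · have := G.ident_comp f
      simp only [hf, hi] at this
      exact this
    · have := G.comp_ident g
      simp only [hg, hi] at this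
      exact this
  rw [← h1, ← h2]
  simp only [one_mul, mul_one]

/-- The crossed module of a 2-group: `G₁` is the group of objects, `G₂` the group of arrows out of
the identity object, `∂` is the target map, and `g` acts on `α` by `g⁻¹ α g`, where `g` is viewed
as an identity arrow. -/
def toCrossedModule : TwoGroup.{u} ⥤ CrossedModule.{u} where
  obj G :=
    { G₂ := G.src.ker
      G₁ := G.Ob
      bd := G.tgt.comp G.src.ker.subtype
      act := fun α a => ⟨(G.ident a)⁻¹ * α * G.ident a, by
        simp [MonoidHom.mem_ker, MonoidHom.mem_ker.1 α.2]⟩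
      act_one := fun α => by simp
      act_mul := fun α a b => by simp [mul_assoc]
      mul_act := fun α β a => by ext; simp [mul_assoc]
      act_bd := fun α β => by
        ext
        simp only [MonoidHom.comp_apply, Subgroup.coe_subtype, Subgroup.coe_mul,
          InvMemClass.coe_inv]
        have h := G.mul_comm_of_src_tgt (f := β.1) (g := α.1 * (G.ident (G.tgt α.1))⁻¹)
          (MonoidHom.mem_ker.1 β.2) (by simp [G.tgt_ident])
        calc (G.ident (G.tgt α.1))⁻¹ * β.1 * G.ident (G.tgt α.1)
            = α.1⁻¹ * (α.1 * (G.ident (G.tgt α.1))⁻¹ * β.1) * G.ident (G.tgt α.1) := by group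
          _ = α.1⁻¹ * (β.1 * (α.1 * (G.ident (G.tgt α.1))⁻¹)) * G.ident (G.tgt α.1) := by rw [h]
          _ = α.1⁻¹ * β.1 * α.1 := by group
      bd_act := fun β a => by simp [G.tgt_ident] }
  map {G H} P :=
    { p₂ := (P.onArr.comp G.src.ker.subtype).codRestrict H.src.ker (fun α => by
        simp [MonoidHom.mem_ker, P.src_map, MonoidHom.mem_ker.1 α.2])
      p₁ := P.onOb
      bd_map := fun α => P.tgt_map _
      act_map := fun α a => by
        ext
        change (H.ident (P.onOb a))⁻¹ * P.onArr α.1 * H.ident (P.onOb a) =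
          P.onArr ((G.ident a)⁻¹ * α.1 * G.ident a)
        simp [P.ident_map] }

end TwoGroup

/-! ### Extensions of a group relative to a crossed module -/

/-- An object `(E, ρ)` of `𝓑(Γ, G)`, where `G = [∂ : G₂ → G₁]`: a group extension
`1 → G₂ → E → Γ → 1` and a homomorphism `ρ : E → G₁` which restricts to `∂` on `G₂` and satisfies
`α ^ ρ(x) = x⁻¹ α x` for `x ∈ E`, `α ∈ G₂`. -/
structure RelExt (Γ : Type u) [Group Γ] (G : CrossedModule.{u}) : Type (u + 1) where
  E : Type u
  [groupE : Group E]
  ext : GroupExtension G.G₂ E Γ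
  ρ : E →* G.G₁
  ρ_inl : ∀ α, ρ (ext.inl α) = G.bd α
  inl_act : ∀ α x, ext.inl (G.act α (ρ x)) = x⁻¹ * ext.inl α * x

namespace RelExt

attribute [instance] groupE

section

variable {Γ : Type u} [Group Γ] {G : CrossedModule.{u}}

/-- A morphism `(E, ρ) → (E', ρ')`: an isomorphism of extensions (inducing the identity on `G₂`
and on `Γ`) with `ρ' ∘ f = ρ`. -/
@[ext]
structure Hom (X Y : RelExt Γ G) : Type u where
  equiv : X.E ≃* Y.E
  inl_map : ∀ α, equiv (X.ext.inl α) = Y.ext.inl α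
  rightHom_map : ∀ x, Y.ext.rightHom (equiv x) = X.ext.rightHom x
  ρ_map : ∀ x, Y.ρ (equiv x) = X.ρ x

/-- The groupoid `𝓑(Γ, G)`. -/
instance : Groupoid.{u} (RelExt Γ G) where
  Hom := Hom
  id X := ⟨MulEquiv.refl _, fun _ => rfl, fun _ => rfl, fun _ => rfl⟩
  comp f g := ⟨f.equiv.trans g.equiv, fun α => by simp [f.inl_map, g.inl_map],
    fun x => by simp [f.rightHom_map, g.rightHom_map], fun x => by simp [f.ρ_map, g.ρ_map]⟩
  id_comp _ := rfl
  comp_id _ := rfl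
  assoc _ _ _ := rfl
  inv f := ⟨f.equiv.symm, fun α => by simp [← f.inl_map],
    fun x => by simpa using (f.rightHom_map (f.equiv.symm x)).symm,
    fun x => by simpa using (f.ρ_map (f.equiv.symm x)).symm⟩
  inv_comp f := Hom.ext (by ext x; exact f.equiv.apply_symm_apply x)
  comp_inv f := Hom.ext (by ext x; exact f.equiv.symm_apply_apply x)

variable (Γ G) in
/-- `π₀ 𝓑(Γ, G)`: the set of isomorphism classes of pairs `(E, ρ)`. -/
def IsoClasses : Type (u + 1) := Quotient (isIsomorphicSetoid (RelExt Γ G))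

/-- The isomorphism class of `(E, ρ)`. -/
def cls (X : RelExt Γ G) : IsoClasses Γ G := Quotient.mk (isIsomorphicSetoid _) X

theorem cls_eq_of_hom {X Y : RelExt Γ G} (f : X ⟶ Y) : X.cls = Y.cls :=
  Quotient.sound (s := isIsomorphicSetoid _) ⟨(Groupoid.isoEquivHom X Y).symm f⟩

/-- A homomorphism `E → E'` compatible with all structure maps is an isomorphism. -/
theorem cls_eq_of_monoidHom {X Y : RelExt Γ G} (f : X.E →* Y.E)
    (h₁ : ∀ α, f (X.ext.inl α) = Y.ext.inl α)
    (h₂ : ∀ x, Y.ext.rightHom (f x) = X.ext.rightHom x)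
    (h₃ : ∀ x, Y.ρ (f x) = X.ρ x) : X.cls = Y.cls := by
  have hb : Function.Bijective f := by
    constructor
    · refine (injective_iff_map_eq_one f).2 fun x hx => ?_
      have hk : x ∈ X.ext.inl.range := by
        rw [X.ext.range_inl_eq_ker_rightHom, MonoidHom.mem_ker, ← h₂, hx, map_one]
      obtain ⟨α, rfl⟩ := hk
      rw [h₁] at hx
      rw [Y.ext.inl_injective (hx.trans (map_one _).symm), map_one]
    · intro y
      obtain ⟨x, hx⟩ := X.ext.rightHom_surjective (Y.ext.rightHom y)
      have hk : (f x)⁻¹ * y ∈ Y.ext.inl.range := by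
        rw [Y.ext.range_inl_eq_ker_rightHom, MonoidHom.mem_ker, map_mul, map_inv, h₂, hx,
          inv_mul_cancel]
      obtain ⟨α, hα⟩ := hk
      exact ⟨x * X.ext.inl α, by rw [map_mul, h₁, hα, mul_inv_cancel_left]⟩
  exact cls_eq_of_hom (X := X) (Y := Y) ⟨MulEquiv.ofBijective f hb, h₁, h₂, h₃⟩

end

/-! #### Pullback along a homomorphism of groups -/

section

variable {Γ Γ' : Type u} [Group Γ] [Group Γ'] {G : CrossedModule.{u}}

/-- The pullback `(E ×_Γ Γ', ρ ∘ pr₁)` of `(E, ρ)` along `χ : Γ' → Γ`. -/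
def pull (χ : Γ' →* Γ) (X : RelExt Γ G) : RelExt Γ' G where
  E := (X.ext.rightHom.comp (MonoidHom.fst X.E Γ')).eqLocus (χ.comp (MonoidHom.snd X.E Γ'))
  ext :=
    { inl := (X.ext.inl.prod 1).codRestrict _ (fun α => by
        change X.ext.rightHom (X.ext.inl α) = χ 1
        simp)
      rightHom := (MonoidHom.snd X.E Γ').comp (Subgroup.subtype _)
      inl_injective := fun α β h => X.ext.inl_injective (congrArg (fun z => z.1.1) h)
      range_inl_eq_ker_rightHom := by
        ext ⟨⟨x, γ⟩, hx⟩
        change X.ext.rightHom x = χ γ at hx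
        rw [MonoidHom.mem_ker]
        constructor
        · rintro ⟨α, hα⟩
          exact (congrArg (fun z => z.1.2) hα).symm
        · intro h
          change γ = 1 at h
          subst h
          have hk : x ∈ X.ext.inl.range := by
            rw [X.ext.range_inl_eq_ker_rightHom, MonoidHom.mem_ker, hx, map_one]
          obtain ⟨α, rfl⟩ := hk
          exact ⟨α, rfl⟩
      rightHom_surjective := fun γ => by
        obtain ⟨x, hx⟩ := X.ext.rightHom_surjective (χ γ)
        exact ⟨⟨(x, γ), hx⟩, rfl⟩ }
  ρ := (X.ρ.comp (MonoidHom.fst X.E Γ')).comp (Subgroup.subtype _)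
  ρ_inl α := X.ρ_inl α
  inl_act α x := Subtype.ext (Prod.ext (X.inl_act α x.1.1) (by
    change (1 : Γ') = x.1.2⁻¹ * 1 * x.1.2
    simp))

/-- The first projection `E ×_Γ Γ' → E`. -/
def pullFst (χ : Γ' →* Γ) (X : RelExt Γ G) : (X.pull χ).E →* X.E :=
  (MonoidHom.fst X.E Γ').comp (Subgroup.subtype _)

/-- The map `T → E ×_Γ Γ'` with components `f` and `g`. -/
def pullLift (χ : Γ' →* Γ) (X : RelExt Γ G) {T : Type u} [Group T] (f : T →* X.E) (g : T →* Γ')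
    (h : ∀ t, X.ext.rightHom (f t) = χ (g t)) : T →* (X.pull χ).E :=
  (f.prod g).codRestrict _ h

/-- A pair `(E', ρ')` over `Γ'` that maps to `(E, ρ)` over `χ` and the identity of `G` is the
pullback. -/
theorem cls_pull_eq (χ : Γ' →* Γ) (X : RelExt Γ G) (Y : RelExt Γ' G) (f : Y.E →* X.E)
    (h₁ : ∀ α, f (Y.ext.inl α) = X.ext.inl α)
    (h₂ : ∀ y, X.ext.rightHom (f y) = χ (Y.ext.rightHom y))
    (h₃ : ∀ y, X.ρ (f y) = Y.ρ y) : Y.cls = (X.pull χ).cls :=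
  cls_eq_of_monoidHom (pullLift χ X f Y.ext.rightHom h₂)
    (fun α => Subtype.ext (Prod.ext (h₁ α) (Y.ext.rightHom_inl α)))
    (fun _ => rfl) h₃

/-- Pullback on isomorphism classes. -/
def pullCls (χ : Γ' →* Γ) : IsoClasses Γ G → IsoClasses Γ' G :=
  Quotient.lift (s := isIsomorphicSetoid _) (fun X => (X.pull χ).cls) (by
    rintro X Y ⟨f⟩
    exact cls_pull_eq χ Y (X.pull χ) (f.hom.equiv.toMonoidHom.comp (X.pullFst χ))
      (fun α => f.hom.inl_map α)
      (fun y => (f.hom.rightHom_map _).trans y.2)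
      (fun y => f.hom.ρ_map _))

end

/-! #### Pushforward along a morphism of crossed modules -/

section

variable {Γ : Type u} [Group Γ] {G H : CrossedModule.{u}}

/-- `E` acts on `H₂` through `E → G₁ → H₁`; this is the semidirect product `H₂ ⋊ E`. -/
abbrev PushSemi (P : G ⟶ H) (X : RelExt Γ G) : Type u :=
  H.G₂ ⋊[H.leftAct.comp (P.p₁.comp X.ρ)] X.E

/-- The homomorphism `G₂ → H₂ ⋊ E`, `α ↦ p₂(α)⁻¹ α`. -/
def pushRel (P : G ⟶ H) (X : RelExt Γ G) : G.G₂ →* PushSemi P X where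
  toFun α := ⟨(P.p₂ α)⁻¹, X.ext.inl α⟩
  map_one' := by ext <;> simp
  map_mul' α β := by
    ext
    · simp only [SemidirectProduct.mul_left, MonoidHom.comp_apply, CrossedModule.leftAct_apply,
        X.ρ_inl, ← P.bd_map, ← map_inv, H.act_bd]
      simp [mul_assoc]
    · simp

instance pushRel_normal (P : G ⟶ H) (X : RelExt Γ G) : (pushRel P X).range.Normal where
  conj_mem := by
    rintro _ ⟨α, rfl⟩ ⟨n, x⟩
    refine ⟨G.act α (X.ρ x)⁻¹, ?_⟩
    have hx : X.ext.inl (G.act α (X.ρ x)⁻¹) = x * X.ext.inl α * x⁻¹ := by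
      rw [← map_inv, X.inl_act, inv_inv]
    have hp : P.p₂ (G.act α (X.ρ x)⁻¹) = H.leftAct (P.p₁ (X.ρ x)) (P.p₂ α) := by
      rw [← P.act_map, map_inv, CrossedModule.leftAct_apply]
    have hc : ∀ β, H.leftAct (P.p₁ (G.bd α)) β = P.p₂ α * β * (P.p₂ α)⁻¹ := fun β => by
      rw [← P.bd_map, CrossedModule.leftAct_apply, ← map_inv, H.act_bd, inv_inv]
    rw [eq_mul_inv_iff_mul_eq]
    ext
    · simp only [pushRel, MonoidHom.coe_mk, OneHom.coe_mk, SemidirectProduct.mul_left,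
        MonoidHom.comp_apply, hp, hx, map_mul, map_inv, MulAut.mul_apply, X.ρ_inl, hc]
      simp [mul_assoc]
    · simp [pushRel, hx]

/-- The group `(H₂ ⋊ E) / {p₂(α)⁻¹ α}`, i.e. the pushout of `E` along `p₂ : G₂ → H₂`. -/
abbrev PushE (P : G ⟶ H) (X : RelExt Γ G) : Type u := PushSemi P X ⧸ (pushRel P X).range

/-- The inclusion of `H₂` into the pushout. -/
def pushInl (P : G ⟶ H) (X : RelExt Γ G) : H.G₂ →* PushE P X :=
  (QuotientGroup.mk' _).comp SemidirectProduct.inl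

/-- The projection of the pushout onto `Γ`, `(β, x) ↦ x̄`. -/
def pushRightHom (P : G ⟶ H) (X : RelExt Γ G) : PushE P X →* Γ :=
  QuotientGroup.lift _ (X.ext.rightHom.comp SemidirectProduct.rightHom) (by
    rintro _ ⟨α, rfl⟩
    simp [pushRel])

/-- The homomorphism `H₂ ⋊ E → H₁`, `(β, x) ↦ ∂β · p₁(ρ(x))`. -/
def pushSemiρ (P : G ⟶ H) (X : RelExt Γ G) : PushSemi P X →* H.G₁ :=
  SemidirectProduct.lift H.bd (P.p₁.comp X.ρ) (fun x => by
    ext β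
    simp [CrossedModule.leftAct_apply, H.bd_act])

theorem pushSemiρ_apply (P : G ⟶ H) (X : RelExt Γ G) (z : PushSemi P X) :
    pushSemiρ P X z = H.bd z.left * P.p₁ (X.ρ z.right) := rfl

/-- The homomorphism from the pushout to `H₁`, `(β, x) ↦ ∂β · p₁(ρ(x))`. -/
def pushρ (P : G ⟶ H) (X : RelExt Γ G) : PushE P X →* H.G₁ :=
  QuotientGroup.lift _ (pushSemiρ P X) (by
    rintro _ ⟨α, rfl⟩
    simp [pushRel, pushSemiρ_apply, X.ρ_inl, P.bd_map])

theorem pushInl_injective (P : G ⟶ H) (X : RelExt Γ G) : Function.Injective (pushInl P X) := by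
  refine (injective_iff_map_eq_one _).2 fun β hβ => ?_
  obtain ⟨α, hα⟩ := (QuotientGroup.eq_one_iff _).1 hβ
  have h1 : X.ext.inl α = 1 := congrArg SemidirectProduct.right hα
  have h2 : (P.p₂ α)⁻¹ = β := congrArg SemidirectProduct.left hα
  rw [← h2, X.ext.inl_injective (h1.trans (map_one _).symm)]
  simp

theorem range_pushInl (P : G ⟶ H) (X : RelExt Γ G) :
    (pushInl P X).range = (pushRightHom P X).ker := by
  ext z
  obtain ⟨⟨β, x⟩, rfl⟩ := QuotientGroup.mk'_surjective _ z
  rw [MonoidHom.mem_ker]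
  constructor
  · rintro ⟨γ, hγ⟩
    rw [← hγ]
    change X.ext.rightHom 1 = 1
    simp
  · intro h
    change X.ext.rightHom x = 1 at h
    have hk : x ∈ X.ext.inl.range := by
      rw [X.ext.range_inl_eq_ker_rightHom, MonoidHom.mem_ker, h]
    obtain ⟨α, rfl⟩ := hk
    refine ⟨β * P.p₂ α, ?_⟩
    refine (QuotientGroup.eq (s := (pushRel P X).range)).2 ⟨α, ?_⟩
    ext
    · simp [pushRel]
    · simp [pushRel]

theorem pushInl_act (P : G ⟶ H) (X : RelExt Γ G) (β : H.G₂) (z : PushE P X) :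
    pushInl P X (H.act β (pushρ P X z)) = z⁻¹ * pushInl P X β * z := by
  obtain ⟨⟨γ, x⟩, rfl⟩ := QuotientGroup.mk'_surjective _ z
  have key : (SemidirectProduct.inl (H.act β (H.bd γ * P.p₁ (X.ρ x))) : PushSemi P X) =
      (⟨γ, x⟩ : PushSemi P X)⁻¹ * SemidirectProduct.inl β * ⟨γ, x⟩ := by
    rw [mul_assoc, eq_inv_mul_iff_mul_eq]
    ext
    · simp only [SemidirectProduct.mul_left, SemidirectProduct.left_inl,
        SemidirectProduct.right_inl, MonoidHom.comp_apply, CrossedModule.leftAct_apply,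
        ← H.act_mul, mul_inv_cancel_right, H.act_bd, map_one, MulAut.one_apply]
      group
    · simp
  change QuotientGroup.mk' _ (SemidirectProduct.inl (H.act β (H.bd γ * P.p₁ (X.ρ x)))) = _
  rw [key, map_mul, map_mul, map_inv]
  rfl

/-- The pushforward of `(E, ρ)` along a morphism `P : G ⟶ H` of crossed modules: the group is
`(H₂ ⋊ E) / {p₂(α)⁻¹ α}`, i.e. the pushout of `E` along `p₂ : G₂ → H₂`, and the homomorphism to
`H₁` is `(β, x) ↦ ∂β · p₁(ρ(x))`. -/
def push (P : G ⟶ H) (X : RelExt Γ G) : RelExt Γ H where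
  E := PushE P X
  ext :=
    { inl := pushInl P X
      rightHom := pushRightHom P X
      inl_injective := pushInl_injective P X
      range_inl_eq_ker_rightHom := range_pushInl P X
      rightHom_surjective := fun γ => by
        obtain ⟨x, hx⟩ := X.ext.rightHom_surjective γ
        exact ⟨QuotientGroup.mk' _ (SemidirectProduct.inr x), hx⟩ }
  ρ := pushρ P X
  ρ_inl β := by
    change H.bd β * P.p₁ (X.ρ 1) = H.bd β
    simp
  inl_act β z := pushInl_act P X β z

/-- The canonical map from `E` to the pushforward. -/
def pushInr (P : G ⟶ H) (X : RelExt Γ G) : X.E →* (X.push P).E :=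
  (QuotientGroup.mk' _).comp SemidirectProduct.inr

theorem pushInr_inl (P : G ⟶ H) (X : RelExt Γ G) (α : G.G₂) :
    X.pushInr P (X.ext.inl α) = (X.push P).ext.inl (P.p₂ α) := by
  refine ((QuotientGroup.eq (s := (pushRel P X).range)).2 ⟨α, ?_⟩).symm
  ext
  · simp [pushRel]
  · simp [pushRel]

theorem rightHom_pushInr (P : G ⟶ H) (X : RelExt Γ G) (x : X.E) :
    (X.push P).ext.rightHom (X.pushInr P x) = X.ext.rightHom x := rfl

theorem ρ_pushInr (P : G ⟶ H) (X : RelExt Γ G) (x : X.E) :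
    (X.push P).ρ (X.pushInr P x) = P.p₁ (X.ρ x) := by
  change H.bd 1 * P.p₁ (X.ρ x) = _
  simp

/-- A pair `(E', ρ')` relative to `H` that receives a map from `(E, ρ)` over `P` and the identity
of `Γ` is the pushforward. -/
theorem cls_push_eq (P : G ⟶ H) (X : RelExt Γ G) (Y : RelExt Γ H) (f : X.E →* Y.E)
    (h₁ : ∀ α, f (X.ext.inl α) = Y.ext.inl (P.p₂ α))
    (h₂ : ∀ x, Y.ext.rightHom (f x) = X.ext.rightHom x)
    (h₃ : ∀ x, Y.ρ (f x) = P.p₁ (X.ρ x)) : (X.push P).cls = Y.cls := by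
  have hc : ∀ x : X.E, Y.ext.inl.comp
      ((H.leftAct.comp (P.p₁.comp X.ρ) x).toMonoidHom) =
      (MulAut.conj (f x)).toMonoidHom.comp Y.ext.inl := fun x => by
    ext β
    simp only [MonoidHom.comp_apply, MulEquiv.toMonoidHom_eq_coe, MonoidHom.coe_coe,
      CrossedModule.leftAct_apply, MulAut.conj_apply]
    rw [← h₃, ← map_inv, Y.inl_act, inv_inv]
  refine cls_eq_of_monoidHom (X := X.push P) (Y := Y)
    (QuotientGroup.lift _ (SemidirectProduct.lift Y.ext.inl f hc) ?_) ?_ ?_ ?_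
  · rintro _ ⟨α, rfl⟩
    simp [pushRel, SemidirectProduct.lift, h₁]
  · intro β
    change SemidirectProduct.lift Y.ext.inl f hc (SemidirectProduct.inl β) = _
    simp
  · intro z
    obtain ⟨⟨β, x⟩, rfl⟩ := QuotientGroup.mk'_surjective _ z
    change Y.ext.rightHom (Y.ext.inl β * f x) = X.ext.rightHom x
    simp [h₂]
  · intro z
    obtain ⟨⟨β, x⟩, rfl⟩ := QuotientGroup.mk'_surjective _ z
    change Y.ρ (Y.ext.inl β * f x) = H.bd β * P.p₁ (X.ρ x)
    rw [map_mul, Y.ρ_inl, h₃]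

/-- Pushforward on isomorphism classes. -/
def pushCls (P : G ⟶ H) : IsoClasses Γ G → IsoClasses Γ H :=
  Quotient.lift (s := isIsomorphicSetoid _) (fun X => (X.push P).cls) (by
    rintro X Y ⟨f⟩
    refine cls_push_eq P X (Y.push P) ((Y.pushInr P).comp f.hom.equiv.toMonoidHom) ?_ ?_ ?_
    · intro α
      exact (congrArg (Y.pushInr P) (f.hom.inl_map α)).trans (Y.pushInr_inl P α)
    · intro x
      exact f.hom.rightHom_map x
    · intro x
      exact (Y.ρ_pushInr P _).trans (congrArg P.p₁ (f.hom.ρ_map x)))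

end

/-! #### The functor `π₀ 𝓑` -/

/-- The functor `(Γ, G) ↦ π₀ 𝓑(Γ, G)`, contravariant in the group `Γ` by pullback and covariant in
the crossed module `G` by pushforward. -/
def isoClassesFunctor : GrpCat.{u}ᵒᵖ ⥤ CrossedModule.{u} ⥤ Type (u + 1) where
  obj Γ :=
    { obj := fun G => IsoClasses Γ.unop G
      map := fun P => TypeCat.ofHom (pushCls P)
      map_id := fun G => by
        ext c
        obtain ⟨X, rfl⟩ := Quotient.exists_rep c
        exact cls_push_eq (𝟙 G) X X (MonoidHom.id _) (fun _ => rfl) (fun _ => rfl) (fun _ => rfl)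
      map_comp := fun P Q => by
        ext c
        obtain ⟨X, rfl⟩ := Quotient.exists_rep c
        refine cls_push_eq (P ≫ Q) X ((X.push P).push Q)
          (((X.push P).pushInr Q).comp (X.pushInr P)) ?_ ?_ ?_
        · intro α
          exact (congrArg ((X.push P).pushInr Q) (X.pushInr_inl P α)).trans
            ((X.push P).pushInr_inl Q _)
        · exact fun _ => rfl
        · intro x
          exact ((X.push P).ρ_pushInr Q _).trans (congrArg Q.p₁ (X.ρ_pushInr P x)) }
  map χ :=
    { app := fun G => TypeCat.ofHom (pullCls χ.unop.hom)
      naturality := fun G H P => by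
        ext c
        obtain ⟨X, rfl⟩ := Quotient.exists_rep c
        refine (cls_push_eq P (X.pull χ.unop.hom) ((X.push P).pull χ.unop.hom)
          (pullLift χ.unop.hom (X.push P) ((X.pushInr P).comp (X.pullFst χ.unop.hom))
            (X.pull χ.unop.hom).ext.rightHom (fun t => t.2)) ?_ ?_ ?_).symm
        · intro α
          exact Subtype.ext (Prod.ext (X.pushInr_inl P α) rfl)
        · exact fun _ => rfl
        · intro x
          exact X.ρ_pushInr P _ }
  map_id Γ := by
    ext G c
    obtain ⟨X, rfl⟩ := Quotient.exists_rep c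
    exact (cls_pull_eq (MonoidHom.id _) X X (MonoidHom.id _) (fun _ => rfl) (fun _ => rfl)
      (fun _ => rfl)).symm
  map_comp χ ψ := by
    ext G c
    obtain ⟨X, rfl⟩ := Quotient.exists_rep c
    exact (cls_pull_eq (χ.unop.hom.comp ψ.unop.hom) X ((X.pull χ.unop.hom).pull ψ.unop.hom)
      ((X.pullFst _).comp ((X.pull χ.unop.hom).pullFst _)) (fun _ => rfl)
      (fun y => y.1.1.2.trans (congrArg χ.unop.hom y.2)) (fun _ => rfl)).symm

end RelExt

/-! ### Homotopy classes of maps from a group to a 2-group -/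

/-- The functor `(Γ, 𝔾) ↦ Hom_{Ho(2Gp)}(Γ, 𝔾)`. -/
def homotopyClasses : GrpCat.{u}ᵒᵖ ⥤ TwoGroup.{u} ⥤ Type (u + 1) :=
  (TwoGroup.discrete ⋙ TwoGroup.toHo).op ⋙ coyoneda ⋙
    (Functor.whiskeringLeft _ _ _).obj TwoGroup.toHo

/-- The functor `(Γ, 𝔾) ↦ π₀ 𝓑(Γ, 𝔾)`, where `𝔾` is regarded as a crossed module. -/
def relExtClasses : GrpCat.{u}ᵒᵖ ⥤ TwoGroup.{u} ⥤ Type (u + 1) :=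
  RelExt.isoClassesFunctor ⋙ (Functor.whiskeringLeft _ _ _).obj TwoGroup.toCrossedModule

namespace TwoGroup

/-- If `w : 𝔽 → Γ` is an equivalence from a 2-group to a group, then the group of objects `F₁` of
`𝔽` is an extension of `Γ` by `F₂`, and `(F₁, id)` is an object of `𝓑(Γ, 𝔽)`. -/
def resolutionExt {Γ : GrpCat.{u}} {F : TwoGroup.{u}} (w : F ⟶ discrete.obj Γ)
    (hw : equivalences w) : RelExt Γ (toCrossedModule.obj F) where
  E := F.Ob
  ext :=
    { inl := (toCrossedModule.obj F).bd
      rightHom := w.onOb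
      inl_injective := by
        refine (injective_iff_map_eq_one _).2 fun α hα => ?_
        have hα' : F.tgt α.1 = 1 := hα
        have hs : F.src α.1 = 1 := MonoidHom.mem_ker.1 α.2
        have h1 : (⟨α.1, ⟨hs, hα'⟩⟩ : F.pi₂) = 1 := by
          apply hw.2.1
          ext
          rw [map_one]
          exact (w.src_map α.1).trans ((congrArg w.onOb hs).trans (map_one _))
        exact Subtype.ext (congrArg (fun z : F.pi₂ => z.1) h1)
      range_inl_eq_ker_rightHom := by
        refine Subgroup.ext fun (a : F.Ob) => ?_
        constructor
        · rintro ⟨α, rfl⟩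
          have hs : F.src α.1 = 1 := MonoidHom.mem_ker.1 α.2
          have h1 : w.onArr α.1 = w.onOb (F.tgt α.1) := w.tgt_map α.1
          have h2 : w.onArr α.1 = w.onOb (F.src α.1) := w.src_map α.1
          have h3 : w.onOb (F.tgt α.1) = 1 := by rw [← h1, h2, hs, map_one]
          exact h3
        · intro ha
          have ha' : w.onOb a = 1 := ha
          have h1 : ((1 : F.Ob) : F.pi₁) = (a : F.pi₁) := by
            apply hw.1.1
            change ((w.onOb 1 : (discrete.obj Γ).Ob) : (discrete.obj Γ).pi₁) =
              ((w.onOb a : (discrete.obj Γ).Ob) : (discrete.obj Γ).pi₁)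
            rw [ha', map_one]
          obtain ⟨f, hf, hfa⟩ := (Con.eq _).1 h1
          exact ⟨⟨f, hf⟩, hfa⟩
      rightHom_surjective := fun γ => by
        let γ' : (discrete.obj Γ).Ob := γ
        obtain ⟨c, hc⟩ := hw.1.2 (γ' : (discrete.obj Γ).pi₁)
        obtain ⟨a, rfl⟩ := Con.mk'_surjective c
        obtain ⟨f, hf, hfa⟩ := (Con.eq (discrete.obj Γ).isoCon).1 hc
        exact ⟨a, hf.symm.trans hfa⟩ }
  ρ := MonoidHom.id _
  ρ_inl _ := rfl
  inl_act α x := (toCrossedModule.obj F).bd_act α x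

end TwoGroup

end

/-! The claim is that, for fixed `Γ`, the functor `π₀ 𝓑(Γ, -)` on the homotopy category is
represented by `Γ` itself, with the tautological pair `(Γ, id)` as universal element. The proof is a
Yoneda argument and needs no calculus of fractions.

The functor descends to the homotopy category because pushforward along an equivalence `G → H` is
bijective on classes (`pushCls_bijective`): a pair `(E, ρ)` relative to `H` can be restricted to `G₁
×_{H₁} E`, and this restriction inverts pushforward. A morphism `f : Γ → 𝔾` of the homotopy category
then yields the class `clsOfHo f`, the image of `(Γ, id)` under `f`.

Conversely, a pair `(E, ρ)` gives a span from `Γ` to `𝔾`. Its apex is the kernel pair of `E → Γ`,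
viewed as a 2-group; the left leg is an equivalence, and the right leg is `ρ` on objects. Inverting
the left leg defines `hoHomCls`, which is natural in `𝔾`.

The two assignments are mutually inverse for two reasons. The pair `(E, id)` over the kernel pair
pushes forward to `(E, ρ)` (`cls_push_kernelPairHom`). In the other direction, a natural
transformation to a representable functor that sends `(Γ, id)` to the identity (`hoHom_trivialExt`)
sends the image of `(Γ, id)` under `f` to `f`. Naturality in `Γ` likewise reduces to the
tautological pair (`cls_push_discrete`), and the formula for `P ∘ w⁻¹` to the case of `w⁻¹`. -/

noncomputable section


/-! ### Weak equivalences of crossed modules and bijectivity of pushforward -/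

namespace CrossedModule

/-- A morphism of crossed modules that induces bijections on the kernels and on the cokernels of
the boundary maps. -/
structure IsWeakEquivalence {G H : CrossedModule.{u}} (P : G ⟶ H) : Prop where
  eq_one : ∀ α, G.bd α = 1 → P.p₂ α = 1 → α = 1
  exists_p₂_eq : ∀ β, H.bd β = 1 → ∃ α, G.bd α = 1 ∧ P.p₂ α = β
  exists_bd_eq : ∀ a β, P.p₁ a = H.bd β → ∃ α, G.bd α = a
  exists_p₁_eq : ∀ b, ∃ a β, P.p₁ a = b * H.bd β

end CrossedModule

namespace RelExt

variable {Γ : Type u} [Group Γ] {G H : CrossedModule.{u}}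

theorem exists_inl_eq (X : RelExt Γ G) {x : X.E} (hx : X.ext.rightHom x = 1) :
    ∃ α, X.ext.inl α = x := by
  have h : x ∈ X.ext.inl.range := by
    rwa [X.ext.range_inl_eq_ker_rightHom, MonoidHom.mem_ker]
  exact h

/-- The restriction `(G₁ ×_{H₁} E, pr₁)` of `(E, ρ)` along a weak equivalence `G ⟶ H` of crossed
modules. -/
def restrict (P : G ⟶ H) (hP : CrossedModule.IsWeakEquivalence P) (Y : RelExt Γ H) :
    RelExt Γ G where
  E := (P.p₁.comp (MonoidHom.fst G.G₁ Y.E)).eqLocus (Y.ρ.comp (MonoidHom.snd G.G₁ Y.E))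
  ext :=
    { inl := (G.bd.prod (Y.ext.inl.comp P.p₂)).codRestrict _ (fun α => by
        change P.p₁ (G.bd α) = Y.ρ (Y.ext.inl (P.p₂ α))
        rw [Y.ρ_inl, P.bd_map])
      rightHom := (Y.ext.rightHom.comp (MonoidHom.snd G.G₁ Y.E)).comp (Subgroup.subtype _)
      inl_injective := by
        refine (injective_iff_map_eq_one _).2 fun α hα => ?_
        have h₁ : G.bd α = 1 := congrArg (fun z => z.1.1) hα
        have h₂ : Y.ext.inl (P.p₂ α) = 1 := congrArg (fun z => z.1.2) hα
        exact hP.eq_one α h₁ (Y.ext.inl_injective (h₂.trans (map_one _).symm))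
      range_inl_eq_ker_rightHom := by
        ext ⟨⟨a, y⟩, hy⟩
        change P.p₁ a = Y.ρ y at hy
        rw [MonoidHom.mem_ker]
        constructor
        · rintro ⟨α, hα⟩
          have h : Y.ext.inl (P.p₂ α) = y := congrArg (fun z => z.1.2) hα
          change Y.ext.rightHom y = 1
          rw [← h, Y.ext.rightHom_inl]
        · intro h
          change Y.ext.rightHom y = 1 at h
          obtain ⟨β, rfl⟩ := Y.exists_inl_eq h
          rw [Y.ρ_inl] at hy
          obtain ⟨α, rfl⟩ := hP.exists_bd_eq a β hy
          -- The element `α` has the right boundary, but `p₂ α` may differ from `β`. The two have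
          -- equal boundary, so the discrepancy lies in `ker ∂` and lifts to a correction `α'` in
          -- the kernel of `∂`.
          obtain ⟨α', h₁, h₂⟩ := hP.exists_p₂_eq ((P.p₂ α)⁻¹ * β) (by
            rw [map_mul, map_inv, P.bd_map, hy, inv_mul_cancel])
          refine ⟨α * α', Subtype.ext (Prod.ext ?_ ?_)⟩
          · change G.bd (α * α') = G.bd α
            rw [map_mul, h₁, mul_one]
          · change Y.ext.inl (P.p₂ (α * α')) = Y.ext.inl β
            rw [map_mul, h₂, mul_inv_cancel_left]
      rightHom_surjective := fun γ => by
        obtain ⟨y, hy⟩ := Y.ext.rightHom_surjective γ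
        obtain ⟨a, β, h⟩ := hP.exists_p₁_eq (Y.ρ y)
        refine ⟨⟨(a, y * Y.ext.inl β), ?_⟩, ?_⟩
        · change P.p₁ a = Y.ρ (y * Y.ext.inl β)
          rw [map_mul, Y.ρ_inl, h]
        · change Y.ext.rightHom (y * Y.ext.inl β) = γ
          rw [map_mul, Y.ext.rightHom_inl, mul_one, hy] }
  ρ := (MonoidHom.fst G.G₁ Y.E).comp (Subgroup.subtype _)
  ρ_inl _ := rfl
  inl_act α x := Subtype.ext (Prod.ext (G.bd_act α x.1.1) (by
    change Y.ext.inl (P.p₂ (G.act α x.1.1)) = x.1.2⁻¹ * Y.ext.inl (P.p₂ α) * x.1.2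
    have hx : P.p₁ x.1.1 = Y.ρ x.1.2 := x.2
    rw [← Y.inl_act, ← P.act_map, hx]))

/-- A pair relative to `G` that maps to `(E, ρ)` over a weak equivalence `G ⟶ H` and the identity
of `Γ` is the restriction. -/
theorem cls_restrict_eq (P : G ⟶ H) (hP : CrossedModule.IsWeakEquivalence P) (X : RelExt Γ G)
    (Y : RelExt Γ H) (f : X.E →* Y.E) (h₁ : ∀ α, f (X.ext.inl α) = Y.ext.inl (P.p₂ α))
    (h₂ : ∀ x, Y.ext.rightHom (f x) = X.ext.rightHom x) (h₃ : ∀ x, Y.ρ (f x) = P.p₁ (X.ρ x)) :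
    X.cls = (Y.restrict P hP).cls :=
  cls_eq_of_monoidHom (Y := Y.restrict P hP)
    ((X.ρ.prod f).codRestrict _ (fun x => (h₃ x).symm))
    (fun α => Subtype.ext (Prod.ext (X.ρ_inl α) (h₁ α))) h₂ (fun _ => rfl)

/-- Restriction along `P` is a two-sided inverse. If the pushforwards of `X` and `Y` are isomorphic,
both pairs map to the pushforward of `Y` over `P`, hence both are its restriction. The second
projection `G₁ ×_{H₁} E → E` exhibits `E` as the pushforward of its restriction. -/
theorem pushCls_bijective (P : G ⟶ H) (hP : CrossedModule.IsWeakEquivalence P) :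
    Function.Bijective (pushCls (Γ := Γ) P) := by
  constructor
  · intro c d h
    obtain ⟨X, rfl⟩ := Quotient.exists_rep c
    obtain ⟨Y, rfl⟩ := Quotient.exists_rep d
    obtain ⟨e⟩ := Quotient.exact (s := isIsomorphicSetoid (RelExt Γ H)) h
    refine (cls_restrict_eq P hP X (Y.push P) (e.hom.equiv.toMonoidHom.comp (X.pushInr P))
      (fun α => ?_) (fun x => ?_) (fun x => ?_)).trans
      (cls_restrict_eq P hP Y (Y.push P) (Y.pushInr P) (Y.pushInr_inl P) (Y.rightHom_pushInr P)
        (Y.ρ_pushInr P)).symm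
    · exact (congrArg e.hom.equiv (X.pushInr_inl P α)).trans (e.hom.inl_map _)
    · exact (e.hom.rightHom_map _).trans (X.rightHom_pushInr P x)
    · exact (e.hom.ρ_map _).trans (X.ρ_pushInr P x)
  · intro d
    obtain ⟨Y, rfl⟩ := Quotient.exists_rep d
    exact ⟨(Y.restrict P hP).cls, cls_push_eq P (Y.restrict P hP) Y
      ((MonoidHom.snd G.G₁ Y.E).comp (Subgroup.subtype _)) (fun _ => rfl) (fun _ => rfl)
      (fun x => x.2.symm)⟩

end RelExt

/-! ### Equivalences of 2-groups and kernel pairs of homomorphisms -/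

namespace TwoGroup

theorem isWeakEquivalence_toCrossedModule {G H : TwoGroup.{u}} (P : G ⟶ H)
    (hP : equivalences P) : CrossedModule.IsWeakEquivalence (toCrossedModule.map P) where
  eq_one α h₁ h₂ := by
    have h : (⟨α.1, α.2, h₁⟩ : G.pi₂) = 1 :=
      hP.2.1 (Subtype.ext ((congrArg Subtype.val h₂).trans
        (congrArg Subtype.val (map_one (pi₂Map P))).symm))
    exact Subtype.ext (congrArg (fun z : G.pi₂ => z.1) h)
  exists_p₂_eq β h := by
    obtain ⟨α, hα⟩ := hP.2.2 ⟨β.1, β.2, h⟩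
    exact ⟨⟨α.1, α.2.1⟩, α.2.2, Subtype.ext (congrArg (fun z : H.pi₂ => z.1) hα)⟩
  exists_bd_eq a β h := by
    let a' : G.Ob := a
    have h₁ : ((1 : G.Ob) : G.pi₁) = (a' : G.pi₁) := by
      apply hP.1.1
      refine (Con.eq _).2 ⟨β.1, ?_, h.symm⟩
      exact (MonoidHom.mem_ker.1 β.2).trans (map_one P.onOb).symm
    obtain ⟨f, hf, hfa⟩ := (Con.eq _).1 h₁
    exact ⟨⟨f, hf⟩, hfa⟩
  exists_p₁_eq b := by
    let b' : H.Ob := b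
    obtain ⟨c, hc⟩ := hP.1.2 (b' : H.pi₁)
    obtain ⟨a, rfl⟩ := Con.mk'_surjective c
    obtain ⟨f, hf, hfa⟩ := (Con.eq H.isoCon).1 hc.symm
    -- Translating the arrow `f : b' → P a` by the identity arrow of `b'` makes it start at the
    -- identity object, so that it becomes an element of `H₂`.
    refine ⟨a, ⟨(H.ident b')⁻¹ * f, ?_⟩, ?_⟩
    · rw [MonoidHom.mem_ker, map_mul, map_inv, H.src_ident, hf, inv_mul_cancel]
    · change P.onOb a = b' * H.tgt ((H.ident b')⁻¹ * f)
      rw [map_mul, map_inv, H.tgt_ident, hfa, mul_inv_cancel_left]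

/-- The interchange law determines composition from the group structure. This lets compatibility
with composition be checked as an identity in a group. -/
theorem comp_eq (G : TwoGroup.{u}) (f g : G.Arr) (h : G.tgt f = G.src g) :
    G.comp f g h = g * (G.ident (G.src g))⁻¹ * f := by
  have hi : G.ident 1 = 1 := map_one _
  have h₀ : G.src (g * (G.ident (G.src g))⁻¹) = 1 := by simp [G.src_ident]
  -- The composable pair `(f, g)` is the product of two pairs, each containing an identity arrow.
  have key := G.comp_mul 1 (g * (G.ident (G.src g))⁻¹) f (G.ident (G.src g))
    (by simp [G.src_ident]) (by rw [h, G.src_ident])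
  have h₁ := G.ident_comp (g * (G.ident (G.src g))⁻¹)
  simp only [h₀, hi] at h₁
  have h₂ := G.comp_ident f
  simp only [h] at h₂
  rw [h₁, h₂] at key
  simpa only [one_mul, inv_mul_cancel_right] using key

/-- The 2-group of a homomorphism `π : E → Γ`: its objects are the elements of `E`, and there is a
unique arrow `x → y` whenever `π x = π y`. -/
def kernelPair {E Γ : Type u} [Group E] [Group Γ] (π : E →* Γ) : TwoGroup.{u} where
  Ob := E
  Arr := (π.comp (MonoidHom.fst E E)).eqLocus (π.comp (MonoidHom.snd E E))
  src := (MonoidHom.fst E E).comp (Subgroup.subtype _)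
  tgt := (MonoidHom.snd E E).comp (Subgroup.subtype _)
  ident := ((MonoidHom.id E).prod (MonoidHom.id E)).codRestrict _ (fun _ => rfl)
  comp f g h := ⟨(f.1.1, g.1.2), by
    have hf : π f.1.1 = π f.1.2 := f.2
    have hg : π g.1.1 = π g.1.2 := g.2
    have h' : f.1.2 = g.1.1 := h
    change π f.1.1 = π g.1.2
    rw [hf, h', hg]⟩
  src_ident _ := rfl
  tgt_ident _ := rfl
  src_comp _ _ _ := rfl
  tgt_comp _ _ _ := rfl
  ident_comp _ := rfl
  comp_ident _ := rfl
  assoc _ _ _ _ _ := rfl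
  comp_mul _ _ _ _ _ _ := rfl
  exists_inv f := ⟨⟨f.1.swap, f.2.symm⟩, rfl, rfl, rfl, rfl⟩

/-- The projection of the 2-group of `π : E → Γ` to `Γ`. -/
def kernelPairProj {E : Type u} [Group E] {Γ : GrpCat.{u}} (π : E →* Γ) :
    kernelPair π ⟶ discrete.obj Γ where
  onOb := π
  onArr := (π.comp (MonoidHom.fst E E)).comp (Subgroup.subtype _)
  src_map _ := rfl
  tgt_map f := f.2
  ident_map _ := rfl
  comp_map _ _ _ := rfl

/-- Isomorphism classes of objects are the fibres of `π`, so `π₁` is `Γ`. Arrows are determined by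
their endpoints on both sides, so both groups `π₂` are trivial. -/
theorem equivalences_kernelPairProj {E : Type u} [Group E] {Γ : GrpCat.{u}} (π : E →* Γ)
    (hπ : Function.Surjective π) : equivalences (kernelPairProj π) := by
  refine ⟨⟨?_, ?_⟩, ⟨?_, ?_⟩⟩
  · intro c d h
    obtain ⟨x, rfl⟩ := Con.mk'_surjective c
    obtain ⟨y, rfl⟩ := Con.mk'_surjective d
    obtain ⟨f, hf, hf'⟩ := (Con.eq (discrete.obj Γ).isoCon).1 h
    exact (Con.eq _).2 ⟨⟨(x, y), hf.symm.trans hf'⟩, rfl, rfl⟩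
  · intro c
    obtain ⟨γ, rfl⟩ := Con.mk'_surjective c
    obtain ⟨x, hx⟩ := hπ γ
    exact ⟨(kernelPair π).isoCon.mk' x, congrArg (discrete.obj Γ).isoCon.mk' hx⟩
  · intro f g _
    have hf := f.2
    have hg := g.2
    exact Subtype.ext (Subtype.ext (Prod.ext
      ((MonoidHom.mem_ker.1 hf.1).trans (MonoidHom.mem_ker.1 hg.1).symm)
      ((MonoidHom.mem_ker.1 hf.2).trans (MonoidHom.mem_ker.1 hg.2).symm)))
  · intro f
    exact ⟨1, Subtype.ext ((congrArg Subtype.val (map_one (pi₂Map (kernelPairProj π)))).trans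
      (MonoidHom.mem_ker.1 f.2.1).symm)⟩

/-- A homomorphism over `Γ` induces a strict morphism of kernel pairs. -/
def kernelPairMap {E E' Γ : Type u} [Group E] [Group E'] [Group Γ] (π : E →* Γ) (π' : E' →* Γ)
    (f : E →* E') (h : ∀ x, π' (f x) = π x) : kernelPair π ⟶ kernelPair π' where
  onOb := f
  onArr := ((f.prodMap f).comp (Subgroup.subtype _)).codRestrict _ (fun z => by
    change π' (f z.1.1) = π' (f z.1.2)
    rw [h, h]
    exact z.2)
  src_map _ := rfl
  tgt_map _ := rfl
  ident_map _ := rfl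
  comp_map _ _ _ := rfl

end TwoGroup

/-! ### The strict morphism from a kernel pair defined by a pair `(E, ρ)` -/

namespace RelExt

open TwoGroup

section

variable {Γ : Type u} [Group Γ] {G : TwoGroup.{u}} (X : RelExt Γ (toCrossedModule.obj G))

theorem exists_quot (f : (kernelPair X.ext.rightHom).Arr) :
    ∃ α, X.ext.inl α = f.1.2 * f.1.1⁻¹ := by
  have hf : X.ext.rightHom f.1.1 = X.ext.rightHom f.1.2 := f.2
  exact X.exists_inl_eq (by rw [map_mul, map_inv, hf, mul_inv_cancel])

/-- The element `y x⁻¹` of `G₂`, for an arrow `x → y` of the kernel pair of `E → Γ`. -/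
def quot (f : (kernelPair X.ext.rightHom).Arr) : (toCrossedModule.obj G).G₂ :=
  (X.exists_quot f).choose

theorem inl_quot (f : (kernelPair X.ext.rightHom).Arr) :
    X.ext.inl (X.quot f) = f.1.2 * f.1.1⁻¹ := (X.exists_quot f).choose_spec

theorem quot_eq {f : (kernelPair X.ext.rightHom).Arr} {α : (toCrossedModule.obj G).G₂}
    (h : X.ext.inl α = f.1.2 * f.1.1⁻¹) : X.quot f = α :=
  X.ext.inl_injective ((X.inl_quot f).trans h.symm)

/-- The map `ρ`, as a homomorphism to the group of objects of `G`. -/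
abbrev ρOb : X.E →* G.Ob := X.ρ

/-- For arrows `x → y` and `x' → y'` one has `yy'(xx')⁻¹ = (yx⁻¹) · x(y'x'⁻¹)x⁻¹`, and conjugation
by `x` on `G₂` is the action through `ρ(x)`. -/
theorem quot_mul (f g : (kernelPair X.ext.rightHom).Arr) :
    (X.quot (f * g)).1 =
      (X.quot f).1 * (G.ident (X.ρOb f.1.1) * (X.quot g).1 * (G.ident (X.ρOb f.1.1))⁻¹) := by
  have h : X.quot (f * g) =
      X.quot f * (toCrossedModule.obj G).act (X.quot g) (X.ρ f.1.1⁻¹) := by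
    refine X.quot_eq ?_
    rw [map_mul, X.inl_act, X.inl_quot, X.inl_quot]
    change _ = (f.1.2 * g.1.2) * (f.1.1 * g.1.1)⁻¹
    group
  rw [h]
  change (X.quot f).1 * ((G.ident (X.ρOb f.1.1⁻¹))⁻¹ * (X.quot g).1 *
    G.ident (X.ρOb f.1.1⁻¹)) = _
  simp only [map_inv, inv_inv]

/-- The strict morphism from the kernel pair of `E → Γ` to `G` given by `ρ` on objects. -/
def kernelPairHom : kernelPair X.ext.rightHom ⟶ G where
  onOb := X.ρOb
  -- The formula is forced: an arrow `x → y` is the arrow `1 → yx⁻¹` times the identity arrow of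
  -- `x`.
  onArr := MonoidHom.mk' (fun f => (X.quot f).1 * G.ident (X.ρOb f.1.1)) (fun f g => by
    rw [quot_mul]
    have h : X.ρOb (f * g).1.1 = X.ρOb f.1.1 * X.ρOb g.1.1 := map_mul _ _ _
    rw [h, map_mul]
    group)
  src_map f := by
    change G.src ((X.quot f).1 * G.ident (X.ρOb f.1.1)) = X.ρOb f.1.1
    rw [map_mul, MonoidHom.mem_ker.1 (X.quot f).2, G.src_ident, one_mul]
  tgt_map f := by
    change G.tgt ((X.quot f).1 * G.ident (X.ρOb f.1.1)) = X.ρOb f.1.2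
    have h : X.ρOb (X.ext.inl (X.quot f)) = G.tgt (X.quot f).1 := X.ρ_inl _
    rw [map_mul, G.tgt_ident, ← h, ← map_mul, inl_quot, inv_mul_cancel_right]
  ident_map x := by
    change G.ident (X.ρOb x) = (X.quot _).1 * G.ident (X.ρOb x)
    rw [X.quot_eq (α := 1)]
    · exact (one_mul _).symm
    · rw [map_one]
      exact (mul_inv_cancel x).symm
  comp_map f g h := by
    rw [comp_eq]
    change _ = (X.quot ((kernelPair X.ext.rightHom).comp f g h)).1 * G.ident (X.ρOb f.1.1)
    have hs : G.src ((X.quot g).1 * G.ident (X.ρOb g.1.1)) = X.ρOb g.1.1 := by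
      rw [map_mul, MonoidHom.mem_ker.1 (X.quot g).2, G.src_ident, one_mul]
    -- For `x → y → z` this is `zx⁻¹ = (zy⁻¹)(yx⁻¹)`, which reverses the order of composition.
    have hq : X.quot ((kernelPair X.ext.rightHom).comp f g h) = X.quot g * X.quot f := by
      refine X.quot_eq ?_
      have h' : f.1.2 = g.1.1 := h
      rw [map_mul, inl_quot, inl_quot, h']
      change _ = g.1.2 * f.1.1⁻¹
      group
    rw [hq]
    change ((X.quot g).1 * G.ident (X.ρOb g.1.1)) *
      (G.ident (G.src ((X.quot g).1 * G.ident (X.ρOb g.1.1))))⁻¹ *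
      ((X.quot f).1 * G.ident (X.ρOb f.1.1)) =
      ((X.quot g).1 * (X.quot f).1) * G.ident (X.ρOb f.1.1)
    rw [hs]
    group

end

end RelExt

/-! ### From pairs to morphisms of the homotopy category -/

namespace RelExt

open TwoGroup

section

variable {Γ : GrpCat.{u}} {G H : TwoGroup.{u}}

/-- The projection to `Γ` of the kernel pair of `E → Γ`. -/
abbrev proj (X : RelExt Γ (toCrossedModule.obj G)) :
    kernelPair X.ext.rightHom ⟶ discrete.obj Γ :=
  kernelPairProj X.ext.rightHom

theorem equivalences_proj (X : RelExt Γ (toCrossedModule.obj G)) : equivalences X.proj :=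
  equivalences_kernelPairProj _ X.ext.rightHom_surjective

/-- The morphism `Γ ⟶ G` in the homotopy category that is represented by `(E, ρ)`. -/
def hoHom (X : RelExt Γ (toCrossedModule.obj G)) :
    toHo.obj (discrete.obj Γ) ⟶ toHo.obj G :=
  Localization.Construction.wInv X.proj X.equivalences_proj ≫ toHo.map X.kernelPairHom

/-- A map of spans over `Γ` and `H` identifies the morphisms they represent: `m ≫ w = X.proj` gives
`X.proj⁻¹ ≫ m = w⁻¹` after localization. -/
theorem hoHom_eq_of_comp_eq (X : RelExt Γ (toCrossedModule.obj G)) {F : TwoGroup.{u}}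
    (w : F ⟶ discrete.obj Γ) (hw : equivalences w) (P : F ⟶ H) (Q : G ⟶ H)
    (m : kernelPair X.ext.rightHom ⟶ F) (h₁ : m ≫ w = X.proj)
    (h₂ : X.kernelPairHom ≫ Q = m ≫ P) :
    X.hoHom ≫ toHo.map Q = Localization.Construction.wInv w hw ≫ toHo.map P := by
  have h : Localization.Construction.wInv X.proj X.equivalences_proj ≫ toHo.map m =
      Localization.Construction.wInv w hw := by
    refine (Iso.inv_comp_eq (Localization.Construction.wIso X.proj X.equivalences_proj)).2
      ((Iso.eq_comp_inv (Localization.Construction.wIso w hw)).2 ?_)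
    exact (toHo.map_comp m w).symm.trans (congrArg toHo.map h₁)
  rw [hoHom, Category.assoc, ← toHo.map_comp, h₂, toHo.map_comp, ← h, Category.assoc]

/-- A map of pairs over `Q : G ⟶ H` and the identity of `Γ` identifies the morphisms to `H` in the
homotopy category. -/
theorem hoHom_comp (Q : G ⟶ H) (X : RelExt Γ (toCrossedModule.obj G))
    (Y : RelExt Γ (toCrossedModule.obj H)) (f : X.E →* Y.E)
    (h₁ : ∀ α, f (X.ext.inl α) = Y.ext.inl ((toCrossedModule.map Q).p₂ α))
    (h₂ : ∀ x, Y.ext.rightHom (f x) = X.ext.rightHom x)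
    (h₃ : ∀ x, Y.ρ (f x) = (toCrossedModule.map Q).p₁ (X.ρ x)) :
    X.hoHom ≫ toHo.map Q = Y.hoHom := by
  refine X.hoHom_eq_of_comp_eq Y.proj Y.equivalences_proj Y.kernelPairHom Q
    (kernelPairMap _ _ f h₂) ?_ ?_
  · refine TwoGroup.Hom.ext (MonoidHom.ext h₂) (MonoidHom.ext fun z => h₂ z.1.1)
  · refine TwoGroup.Hom.ext (MonoidHom.ext fun x => (h₃ x).symm) (MonoidHom.ext fun z => ?_)
    have hq : Y.quot ((kernelPairMap _ _ f h₂).onArr z) =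
        (toCrossedModule.map Q).p₂ (X.quot z) := by
      refine Y.quot_eq ?_
      rw [← h₁, inl_quot, map_mul, map_inv]
      rfl
    change Q.onArr ((X.quot z).1 * G.ident (X.ρOb z.1.1)) =
      (Y.quot ((kernelPairMap _ _ f h₂).onArr z)).1 * H.ident (Y.ρOb (f z.1.1))
    have h₃' : Y.ρOb (f z.1.1) = Q.onOb (X.ρOb z.1.1) := h₃ _
    rw [hq, map_mul, h₃', Q.ident_map]
    rfl

/-- The identity of `E` is a map from `(E, id)` to `(E, ρ)` over the strict morphism. Only its
effect on kernels needs an argument: an arrow out of the identity object is `(1, y)`, and its image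
in `G₂` is the element that includes to `y`. -/
theorem cls_push_kernelPairHom (X : RelExt Γ (toCrossedModule.obj G)) :
    ((resolutionExt X.proj X.equivalences_proj).push
      (toCrossedModule.map X.kernelPairHom)).cls = X.cls := by
  refine cls_push_eq _ (resolutionExt X.proj X.equivalences_proj) X (MonoidHom.id X.E)
    (fun α => ?_) (fun _ => rfl) (fun _ => rfl)
  have hα : α.1.1.1 = 1 := α.2
  change α.1.1.2 = X.ext.inl ((toCrossedModule.map X.kernelPairHom).p₂ α)
  have h : (toCrossedModule.map X.kernelPairHom).p₂ α = X.quot α.1 := by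
    refine Subtype.ext ?_
    change (X.quot α.1).1 * G.ident (X.ρOb α.1.1.1) = (X.quot α.1).1
    rw [hα, map_one, map_one, mul_one]
  rw [h, inl_quot, hα, inv_one, mul_one]

/-- The morphism in the homotopy category represented by an isomorphism class of pairs. -/
def hoHomCls : IsoClasses Γ (toCrossedModule.obj G) →
    (toHo.obj (discrete.obj Γ) ⟶ toHo.obj G) :=
  Quotient.lift (s := isIsomorphicSetoid _) hoHom (by
    rintro X Y ⟨f⟩
    have h := hoHom_comp (𝟙 G) X Y f.hom.equiv.toMonoidHom f.hom.inl_map f.hom.rightHom_map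
      f.hom.ρ_map
    rwa [toHo.map_id, Category.comp_id] at h)

theorem hoHomCls_pushCls (Q : G ⟶ H) (c : IsoClasses Γ (toCrossedModule.obj G)) :
    hoHomCls (pushCls (toCrossedModule.map Q) c) = hoHomCls c ≫ toHo.map Q := by
  obtain ⟨X, rfl⟩ := Quotient.exists_rep c
  exact (hoHom_comp Q X (X.push _) (X.pushInr _) (X.pushInr_inl _) (X.rightHom_pushInr _)
    (X.ρ_pushInr _)).symm

end

end RelExt

/-! ### The tautological pair over a group -/

namespace TwoGroup

theorem equivalences_id (G : TwoGroup.{u}) : equivalences (𝟙 G) := by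
  refine ⟨⟨?_, ?_⟩, Function.bijective_id⟩
  · intro c d h
    obtain ⟨x, rfl⟩ := Con.mk'_surjective c
    obtain ⟨y, rfl⟩ := Con.mk'_surjective d
    exact h
  · intro c
    obtain ⟨x, rfl⟩ := Con.mk'_surjective c
    exact ⟨G.isoCon.mk' x, rfl⟩

/-- The pair `(Γ, id)`. -/
abbrev trivialExt (Γ : GrpCat.{u}) : RelExt Γ (toCrossedModule.obj (discrete.obj Γ)) :=
  resolutionExt (𝟙 (discrete.obj Γ)) (equivalences_id _)

theorem hoHom_trivialExt (Γ : GrpCat.{u}) : (trivialExt Γ).hoHom = 𝟙 _ := by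
  have hd : (trivialExt Γ).kernelPairHom = (trivialExt Γ).proj := by
    refine TwoGroup.Hom.ext rfl (MonoidHom.ext fun z => ?_)
    -- In a discrete 2-group every arrow equals its source, so the value on arrows is determined by
    -- the value on objects.
    exact ((discrete.obj Γ).src_ident _).symm.trans
      ((trivialExt Γ).kernelPairHom.src_map z)
  rw [RelExt.hoHom, hd]
  exact (Localization.Construction.wIso _ _).inv_hom_id

theorem cls_push_resolutionExt {Γ : GrpCat.{u}} {F : TwoGroup.{u}} (w : F ⟶ discrete.obj Γ)
    (hw : equivalences w) :
    ((resolutionExt w hw).push (toCrossedModule.map w)).cls = (trivialExt Γ).cls :=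
  RelExt.cls_push_eq _ (resolutionExt w hw) (trivialExt Γ) w.onOb
    (fun α => (w.tgt_map α.1).symm) (fun _ => rfl) (fun _ => rfl)

/-- Both classes are represented by `Γ'` with the homomorphism `χ` to `Γ`, through `γ ↦ (χ γ, γ)`.
This is naturality in the group, tested on the universal element. -/
theorem cls_push_discrete {Γ Γ' : GrpCat.{u}} (χ : Γ' ⟶ Γ) :
    ((trivialExt Γ').push (toCrossedModule.map (discrete.map χ))).cls =
      ((trivialExt Γ).pull χ.hom).cls := by
  refine RelExt.cls_push_eq _ (trivialExt Γ') ((trivialExt Γ).pull χ.hom)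
    (RelExt.pullLift χ.hom (trivialExt Γ) χ.hom (MonoidHom.id Γ') (fun _ => rfl))
    (fun α => ?_) (fun _ => rfl) (fun _ => rfl)
  have hα : α.1 = 1 := MonoidHom.mem_ker.1 α.2
  obtain rfl : α = 1 := Subtype.ext hα
  simp only [map_one]

end TwoGroup

/-! ### Descent to the homotopy category and the Yoneda argument -/

open TwoGroup RelExt

theorem relExtClasses_isInvertedBy (Γ : GrpCat.{u}) :
    equivalences.{u}.IsInvertedBy (relExtClasses.{u}.obj (Opposite.op Γ)) := fun _ _ P hP =>
  (isIso_iff_bijective _).2 (pushCls_bijective _ (isWeakEquivalence_toCrossedModule P hP))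

/-- The functor `π₀ 𝓑(Γ, -)` on the homotopy category. -/
def hoRelExtClasses (Γ : GrpCat.{u}) : Ho.{u} ⥤ Type (u + 1) :=
  Localization.Construction.lift (relExtClasses.{u}.obj (Opposite.op Γ))
    (relExtClasses_isInvertedBy Γ)

theorem hoRelExtClasses_map_toHo (Γ : GrpCat.{u}) {G H : TwoGroup.{u}} (P : G ⟶ H) :
    (hoRelExtClasses Γ).map (toHo.map P) = (relExtClasses.obj (Opposite.op Γ)).map P := by
  refine (Functor.congr_hom (Localization.Construction.fac
    (relExtClasses.{u}.obj (Opposite.op Γ)) (relExtClasses_isInvertedBy Γ)) P).trans ?_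
  -- The transports supplied by `Functor.congr_hom` are identities, since the two functors agree
  -- definitionally on objects.
  exact (Category.id_comp _).trans (Category.comp_id _)

theorem hoRelExtClasses_map_toHo_apply {Γ : GrpCat.{u}} {G H : TwoGroup.{u}} (P : G ⟶ H)
    (c : IsoClasses Γ (toCrossedModule.obj G)) :
    (hoRelExtClasses Γ).map (toHo.map P) c = pushCls (toCrossedModule.map P) c := by
  rw [hoRelExtClasses_map_toHo]
  rfl

/-- The class of pairs that corresponds to a morphism of the homotopy category. -/
def clsOfHo {Γ : GrpCat.{u}} {G : TwoGroup.{u}} (f : toHo.obj (discrete.obj Γ) ⟶ toHo.obj G) :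
    IsoClasses Γ (toCrossedModule.obj G) :=
  (hoRelExtClasses Γ).map f (trivialExt Γ).cls

theorem clsOfHo_comp {Γ : GrpCat.{u}} {G H : TwoGroup.{u}}
    (f : toHo.obj (discrete.obj Γ) ⟶ toHo.obj G) (P : G ⟶ H) :
    clsOfHo (f ≫ toHo.map P) = pushCls (toCrossedModule.map P) (clsOfHo f) := by
  rw [clsOfHo, Functor.map_comp, ← hoRelExtClasses_map_toHo_apply]
  rfl

/-- It suffices to treat `w⁻¹`. Pushforward along `w` is injective, and it sends both the class of
`w⁻¹` and that of `(F₁, id)` to the tautological class. -/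
theorem clsOfHo_wInv_comp {Γ : GrpCat.{u}} {F G : TwoGroup.{u}} (w : F ⟶ discrete.obj Γ)
    (hw : equivalences w) (P : F ⟶ G) :
    clsOfHo (Localization.Construction.wInv w hw ≫ toHo.map P) =
      ((resolutionExt w hw).push (toCrossedModule.map P)).cls := by
  have h : clsOfHo (Localization.Construction.wInv w hw) = (resolutionExt w hw).cls := by
    refine (pushCls_bijective _ (isWeakEquivalence_toCrossedModule w hw)).1 ?_
    rw [← clsOfHo_comp]
    refine Eq.trans ?_ (cls_push_resolutionExt w hw).symm
    have h' : Localization.Construction.wInv w hw ≫ toHo.map w = 𝟙 _ :=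
      (Localization.Construction.wIso w hw).inv_hom_id
    rw [h']
    exact ConcreteCategory.congr_hom ((hoRelExtClasses Γ).map_id (toHo.obj (discrete.obj Γ)))
      (trivialExt Γ).cls
  rw [clsOfHo_comp, h]
  rfl

theorem clsOfHo_hoHomCls {Γ : GrpCat.{u}} {G : TwoGroup.{u}}
    (c : IsoClasses Γ (toCrossedModule.obj G)) : clsOfHo (hoHomCls c) = c := by
  obtain ⟨X, rfl⟩ := Quotient.exists_rep c
  exact (clsOfHo_wInv_comp _ _ _).trans X.cls_push_kernelPairHom

/-- The transformation from pairs to morphisms of the homotopy category is natural there. -/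
def hoHomClsNatTrans (Γ : GrpCat.{u}) :
    hoRelExtClasses Γ ⟶ coyoneda.obj (Opposite.op (toHo.obj (discrete.obj Γ))) :=
  -- Naturality on strict morphisms is enough: naturality for the formal inverses of equivalences
  -- follows from it.
  Localization.Construction.natTransExtension
    { app := fun G => TypeCat.ofHom (fun c : IsoClasses Γ (toCrossedModule.obj G) => hoHomCls c)
      naturality := fun G H P => by
        ext c
        exact (congrArg hoHomCls (hoRelExtClasses_map_toHo_apply P c)).trans
          (hoHomCls_pushCls P c) }

theorem hoHomClsNatTrans_app (Γ : GrpCat.{u}) (G : TwoGroup.{u})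
    (c : IsoClasses Γ (toCrossedModule.obj G)) :
    (hoHomClsNatTrans Γ).app (toHo.obj G) c = hoHomCls c := by
  rw [hoHomClsNatTrans, Localization.Construction.natTransExtension_app,
    Localization.Construction.NatTransExtension.app_eq]
  rfl

/-- By naturality along `f`, the image of the tautological class under `f` goes to `𝟙 ≫ f`. -/
theorem hoHomCls_clsOfHo {Γ : GrpCat.{u}} {G : TwoGroup.{u}}
    (f : toHo.obj (discrete.obj Γ) ⟶ toHo.obj G) : hoHomCls (clsOfHo f) = f := by
  rw [← hoHomClsNatTrans_app, clsOfHo]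
  refine (NatTrans.naturality_apply (hoHomClsNatTrans Γ) f (trivialExt Γ).cls).trans ?_
  have h : (hoHomClsNatTrans Γ).app (toHo.obj (discrete.obj Γ)) (trivialExt Γ).cls = 𝟙 _ :=
    (hoHomClsNatTrans_app Γ _ _).trans (hoHom_trivialExt Γ)
  refine (congrArg (fun g => g ≫ f) h).trans (Category.id_comp f)

/-- Pullback along `χ`, as a transformation on the homotopy category. -/
def hoPull {Γ Γ' : GrpCat.{u}} (χ : Γ' ⟶ Γ) : hoRelExtClasses Γ ⟶ hoRelExtClasses Γ' :=
  Localization.Construction.natTransExtension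
    { app := fun G => (relExtClasses.map χ.op).app G
      naturality := fun G H P => by
        have h := (relExtClasses.map χ.op).naturality P
        rw [← hoRelExtClasses_map_toHo, ← hoRelExtClasses_map_toHo] at h
        exact h }

theorem hoPull_app {Γ Γ' : GrpCat.{u}} (χ : Γ' ⟶ Γ) (G : TwoGroup.{u})
    (c : IsoClasses Γ (toCrossedModule.obj G)) :
    (hoPull χ).app (toHo.obj G) c = pullCls χ.hom c := by
  rw [hoPull, Localization.Construction.natTransExtension_app,
    Localization.Construction.NatTransExtension.app_eq]
  rfl

/-- Pullback along `χ` is natural on the homotopy category, so it commutes with `f`; this leaves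
only the tautological class, where pushing along `χ` agrees with pulling back. -/
theorem clsOfHo_discrete_comp {Γ Γ' : GrpCat.{u}} (χ : Γ' ⟶ Γ) {G : TwoGroup.{u}}
    (f : toHo.obj (discrete.obj Γ) ⟶ toHo.obj G) :
    clsOfHo (toHo.map (discrete.map χ) ≫ f) = pullCls χ.hom (clsOfHo f) := by
  have h : (hoRelExtClasses Γ').map (toHo.map (discrete.map χ)) (trivialExt Γ').cls =
      (hoPull χ).app (toHo.obj (discrete.obj Γ)) (trivialExt Γ).cls :=
    (hoRelExtClasses_map_toHo_apply _ _).trans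
      ((cls_push_discrete χ).trans (hoPull_app χ _ (trivialExt Γ).cls).symm)
  rw [← hoPull_app, clsOfHo, clsOfHo, Functor.map_comp]
  exact (congrArg ((hoRelExtClasses Γ').map f) h).trans
    (NatTrans.naturality_apply (hoPull χ) f (trivialExt Γ).cls).symm

/-! ### The natural isomorphism -/

/-- The transformation from homotopy classes of maps to isomorphism classes of pairs. -/
def clsOfHoNatTrans : homotopyClasses.{u} ⟶ relExtClasses.{u} where
  app Γ :=
    { app := fun G => TypeCat.ofHom
        (fun f : toHo.obj (discrete.obj Γ.unop) ⟶ toHo.obj G => clsOfHo f)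
      naturality := fun G H P => by
        ext f
        exact clsOfHo_comp f P }
  naturality Γ Γ' χ := by
    ext G f
    exact clsOfHo_discrete_comp χ.unop f

instance : IsIso clsOfHoNatTrans.{u} := by
  refine (NatTrans.isIso_iff_isIso_app _).2 fun Γ => (NatTrans.isIso_iff_isIso_app _).2 fun G =>
    (isIso_iff_bijective _).2 ⟨?_, ?_⟩
  · exact Function.LeftInverse.injective (g := hoHomCls) hoHomCls_clsOfHo
  · exact Function.RightInverse.surjective (g := hoHomCls) clsOfHo_hoHomCls

end

theorem corollary13p2 :
    ∃ Φ : homotopyClasses.{u} ≅ relExtClasses.{u},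
      ∀ (Γ : GrpCat.{u}) (F G : TwoGroup.{u}) (w : F ⟶ TwoGroup.discrete.obj Γ)
        (hw : TwoGroup.equivalences w) (P : F ⟶ G),
        (Φ.hom.app (Opposite.op Γ)).app G
            (Localization.Construction.wInv w hw ≫ TwoGroup.toHo.map P) =
          ((TwoGroup.resolutionExt w hw).push (TwoGroup.toCrossedModule.map P)).cls := by
  exact ⟨asIso clsOfHoNatTrans, fun _ _ _ w hw P => clsOfHo_wInv_comp w hw P⟩
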